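/- Let $n=2$. Let $\sigma_1,\sigma_2,\sigma_3$ be the left-invariant coframe on $S^3=SU(2)$ for which $\sigma_1^2+\sigma_2^2+\sigma_3^2$ is the unit round metric, let $\Gamma_n=\mathbb Z/n\mathbb Z$ act on $\mathbb C^2$ by scalars, and let $$g_{LEB(n)}=\frac{1+\hat r^2}{n+\hat r^2}\,d\hat r^2+(1+\hat r^2)(\sigma_1^2+\sigma_2^2)+\frac{\hat r^2(n+\hat r^2)}{1+\hat r^2}\,\sigma_3^2,\qquad \hat r\in(0,\infty),$$ be the LeBrun metric on $((0,\infty)\times S^3)/\Gamma_n$. It extends smoothly to $\mathcal O_{\mathbb P^1}(-n)$ by attaching a $\mathbb P^1$ at $\hat r=0$; for $n=2$ it is the Eguchi–Hanson metric. Let $\check g_{LEB(n)}=(n+\hat r^2)^{-2}g_{LEB(n)}$ be its conformal compactification on the compact orbifold $\check{\mathcal O}_{\mathbb P^1}(-n)=\mathcal O_{\mathbb P^1}(-n)\cup\{\check q\}$, which has one orbifold point $\check q$ at $\hat r=\infty$, with group $\Gamma_n$. Put $s=1/\hat r$. Let $\mathcal X_n$ be the set of smooth, $U(2)$-invariant,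 positive functions on $\check{\mathcal O}_{\mathbb P^1}(-n)$ (smoothness at $\check q$ means smoothness of the lift to a uniformizing chart); such a function is a function of $s$. Let $\mathcal Y_n$ be the set of functions on $(0,\infty)$ of the form $h(s)=f(s)/(n+1/s^2)$ with $f\in\mathcal X_n$. Suppose $K\in\mathcal X_2$ satisfies $K'(s)\le 0$ for every $s\ge 0$. Then there is no $v\in\mathcal Y_2$ such that $$\Delta_{g_{LEB(2)}}v=-Kv^3 .$$ Consequently, there is no $u\in\mathcal X_2$, that is, no positive smooth $U(2)$-invariant function on $\check{\mathcal O}_{\mathbb P^1}(-2)$, such that $$-\Delta_{\check g_{LEB(2)}}u+\tfrac16R_{\check g_{LEB(2)}}u=Ku^3,$$ where $R_{\check g_{LEB(2)}}$ is the scalar curvature of $\check g_{LEB(2)}$. -/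

import Mathlib

open scoped ContDiff BigOperators Matrix

noncomputable section

namespace LeBrun

/-! ### The compactified orbifold

Every nonzero `(z, w) ∈ ℂ² × ℂ` represents a point; two representatives are identified by positive
rescaling and by the circle action `λ · (z, w) = (λ z, λ⁻ⁿ w)`. The points with `z ≠ 0` form the
line bundle `S³ ×_{U(1)} ℂ = 𝒪(-n)` over `ℙ¹` (zero section `w = 0`), whose radial coordinate is
`r̂ = |w| / |z|`; the remaining point `[0 : 0 : 1]` is the orbifold point at `r̂ = ∞`, where
`s = 1 / r̂ = |z| / |w|` vanishes. -/

/-- Nonzero vectors of `ℂ² × ℂ`. -/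
abbrev Cone : Type := {p : (Fin 2 → ℂ) × ℂ // p ≠ 0}

/-- The identification `(z, w) ∼ (t λ z, t λ⁻ⁿ w)` for `t > 0` and `|λ| = 1`. -/
def coneSetoid (n : ℕ) : Setoid Cone where
  r p q := ∃ t : ℝ, 0 < t ∧ ∃ c : Circle,
    q.1.1 = ((t : ℂ) * (c : ℂ)) • p.1.1 ∧ q.1.2 = ((t : ℂ) * ((c⁻¹ : Circle) : ℂ) ^ n) * p.1.2
  iseqv :=
    { refl := fun p => ⟨1, one_pos, 1, by simp, by simp⟩
      symm := by
        rintro p q ⟨t, ht, c, h1, h2⟩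
        have ht' : (t : ℂ) ≠ 0 := by exact_mod_cast ht.ne'
        refine ⟨t⁻¹, inv_pos.2 ht, c⁻¹, ?_, ?_⟩
        · rw [h1, smul_smul]
          have : ((t⁻¹ : ℝ) : ℂ) * ((c⁻¹ : Circle) : ℂ) * ((t : ℂ) * (c : ℂ)) = 1 := by
            rw [Circle.coe_inv]; push_cast
            have := Circle.coe_ne_zero c
            field_simp
          rw [this, one_smul]
        · rw [h2]
          have hc := Circle.coe_ne_zero c
          have hcc : ((c : ℂ)) ^ n * ((c : ℂ)⁻¹) ^ n = 1 := by
            rw [← mul_pow, mul_inv_cancel₀ hc, one_pow]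
          rw [inv_inv, Circle.coe_inv, Complex.ofReal_inv]
          calc p.1.2 = ((t : ℂ)⁻¹ * t) * ((c : ℂ) ^ n * ((c : ℂ)⁻¹) ^ n) * p.1.2 := by
                rw [hcc, inv_mul_cancel₀ ht']; ring
            _ = _ := by ring
      trans := by
        rintro p q r ⟨t, ht, c, h1, h2⟩ ⟨t', ht', c', h1', h2'⟩
        refine ⟨t' * t, mul_pos ht' ht, c' * c, ?_, ?_⟩
        · rw [h1', h1, smul_smul]; congr 1; push_cast; ring
        · rw [h2', h2, mul_inv]; push_cast; ring }

/-- The one-point (orbifold) compactification of `𝒪_{ℙ¹}(-n)`. -/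
def Orb (n : ℕ) : Type := Quotient (coneSetoid n)

/-- The point represented by a nonzero `(z, w)`. -/
def Orb.mk (n : ℕ) (z : Fin 2 → ℂ) (w : ℂ) (h : (z, w) ≠ 0) : Orb n :=
  Quotient.mk (coneSetoid n) ⟨(z, w), h⟩

/-- `U(2)` acts on `ℂ² × ℂ` by `A · (z, w) = (A z, w)`. -/
def coneAct (A : Matrix.unitaryGroup (Fin 2) ℂ) (p : Cone) : Cone :=
  ⟨((A : Matrix (Fin 2) (Fin 2) ℂ) *ᵥ p.1.1, p.1.2), by
    intro h
    apply p.2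
    have h1 : (A : Matrix (Fin 2) (Fin 2) ℂ) *ᵥ p.1.1 = 0 := congrArg Prod.fst h
    have h2 : p.1.2 = 0 := congrArg Prod.snd h
    refine Prod.ext ?_ h2
    have hA : star (A : Matrix (Fin 2) (Fin 2) ℂ) * (A : Matrix (Fin 2) (Fin 2) ℂ) = 1 :=
      Matrix.mem_unitaryGroup_iff'.1 A.2
    calc p.1.1 = (star (A : Matrix (Fin 2) (Fin 2) ℂ) * (A : Matrix (Fin 2) (Fin 2) ℂ))
            *ᵥ p.1.1 := by rw [hA, Matrix.one_mulVec]
      _ = 0 := by rw [← Matrix.mulVec_mulVec, h1, Matrix.mulVec_zero]⟩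

/-- The induced action of `U(2)` on the orbifold. -/
def Orb.act (n : ℕ) (A : Matrix.unitaryGroup (Fin 2) ℂ) : Orb n → Orb n :=
  Quotient.map' (s₁ := coneSetoid n) (s₂ := coneSetoid n) (coneAct A) (by
    rintro p q ⟨t, ht, c, h1, h2⟩
    refine ⟨t, ht, c, ?_, h2⟩
    show (A : Matrix (Fin 2) (Fin 2) ℂ) *ᵥ q.1.1 = _ • ((A : Matrix (Fin 2) (Fin 2) ℂ) *ᵥ p.1.1)
    rw [h1, Matrix.mulVec_smul])

/-- `ℝ⁴` with its Euclidean norm, identified with `ℂ²` by `(x₀ + i x₁, x₂ + i x₃)`. -/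
abbrev E4 : Type := EuclideanSpace ℝ (Fin 4)

/-- First complex coordinate. -/
def cx (x : E4) : ℂ := ⟨x 0, x 1⟩

/-- Second complex coordinate. -/
def cy (x : E4) : ℂ := ⟨x 2, x 3⟩

/-- Uniformizing chart at the orbifold point, `ℂ² → ℂ² / Γₙ`, with `s = ‖x‖`. -/
def chartOrb (n : ℕ) (x : E4) : Orb n :=
  Orb.mk n ![cx x, cy x] 1 (fun h => one_ne_zero (congrArg Prod.snd h))

/-- First bundle chart of `𝒪(-n)`: base coordinate `ζ = z₂ / z₁`, linear fibre coordinate. -/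
def chartBdl₁ (n : ℕ) (x : E4) : Orb n :=
  Orb.mk n ![1, cx x] (cy x) (fun h => one_ne_zero (congrFun (congrArg Prod.fst h) 0))

/-- Second bundle chart of `𝒪(-n)`: base coordinate `z₁ / z₂`, linear fibre coordinate. -/
def chartBdl₂ (n : ℕ) (x : E4) : Orb n :=
  Orb.mk n ![cx x, 1] (cy x) (fun h => one_ne_zero (congrFun (congrArg Prod.fst h) 1))

/-- Smooth functions on the orbifold: smooth in the two charts covering `𝒪(-n)`, and with a smooth
lift to the uniformizing chart at the orbifold point. -/
def IsSmooth (n : ℕ) (f : Orb n → ℝ) : Prop :=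
  ContDiff ℝ ∞ (fun x => f (chartBdl₁ n x)) ∧
  ContDiff ℝ ∞ (fun x => f (chartBdl₂ n x)) ∧
  ContDiff ℝ ∞ (fun x => f (chartOrb n x))

/-- The space `𝒳ₙ` of smooth, `U(2)`-invariant, positive functions on the orbifold. -/
def X (n : ℕ) : Set (Orb n → ℝ) :=
  {f | IsSmooth n f ∧ (∀ A p, f (Orb.act n A p) = f p) ∧ ∀ p, 0 < f p}

/-- A `U(2)`-invariant function as a function of the radial coordinate `s`. -/
def radial {n : ℕ} (f : Orb n → ℝ) (s : ℝ) : ℝ := f (chartOrb n (EuclideanSpace.single 0 s))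

/-- The space `𝒴ₙ`: functions `h(s) = f(s) / (n + 1 / s²)` on `(0, ∞)` with `f ∈ 𝒳ₙ`; the values of
`h` outside `(0, ∞)` play no role. -/
def Y (n : ℕ) : Set (ℝ → ℝ) :=
  {h | ∃ f ∈ X n, ∀ s : ℝ, 0 < s → h s = radial f s / (n + 1 / s ^ 2)}

/-! ### Riemannian geometry in coordinates -/

/-- Partial derivative. -/
def pd (i : Fin 4) (f : E4 → ℝ) (x : E4) : ℝ := fderiv ℝ f x (EuclideanSpace.single i 1)

/-- Matrix of coefficients of a metric. -/
abbrev MetricField : Type := E4 → Matrix (Fin 4) (Fin 4) ℝ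

/-- Laplace–Beltrami operator `(det g)^{-1/2} ∂ᵢ ((det g)^{1/2} gⁱʲ ∂ⱼ f)`. -/
def laplacian (g : MetricField) (f : E4 → ℝ) (x : E4) : ℝ :=
  (√(g x).det)⁻¹ *
    ∑ i, pd i (fun y => √(g y).det * ∑ j, (g y)⁻¹ i j * pd j f y) x

/-- Christoffel symbol `Γᵏᵢⱼ`. -/
def christoffel (g : MetricField) (k i j : Fin 4) (x : E4) : ℝ :=
  (1 / 2) * ∑ l, (g x)⁻¹ k l *
    (pd i (fun y => g y j l) x + pd j (fun y => g y i l) x - pd l (fun y => g y i j) x)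

/-- Ricci tensor `∂ₖ Γᵏᵢⱼ - ∂ⱼ Γᵏᵢₖ + Γᵏᵢⱼ Γˡₖₗ - Γᵏᵢₗ Γˡⱼₖ`. -/
def ricci (g : MetricField) (i j : Fin 4) (x : E4) : ℝ :=
  ∑ k, (pd k (christoffel g k i j) x - pd j (christoffel g k i k) x +
    ∑ l, (christoffel g k i j x * christoffel g l k l x -
      christoffel g k i l x * christoffel g l j k x))

/-- Scalar curvature. -/
def scalarCurvature (g : MetricField) (x : E4) : ℝ :=
  ∑ i, ∑ j, (g x)⁻¹ i j * ricci g i j x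

/-! ### The LeBrun metric

The region `0 < s < ∞` of the orbifold is `(ℂ² \ {0}) / Γₙ`. Both metrics are written there in the
uniformizing chart, whose points are `x = s θ` with `s = 1 / r̂ > 0` and `θ ∈ S³`. -/

/-- The radial coordinate `r̂ = 1 / s`. -/
def rhat (x : E4) : ℝ := 1 / ‖x‖

/-- The differential of `r̂`. -/
def drhat (x : E4) : Fin 4 → ℝ := fun i => - x i / ‖x‖ ^ 3

/-- The left-invariant coframe of `S³ = SU(2)`, pulled back by `x ↦ x / ‖x‖`, with
`σ₁² + σ₂² + σ₃²` the unit round metric and `σ₃` dual to the Hopf direction `i x`. -/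
def sigma₁ (x : E4) : Fin 4 → ℝ := fun i => ![- x 2, x 3, x 0, - x 1] i / ‖x‖ ^ 2

/-- Second form of the coframe. -/
def sigma₂ (x : E4) : Fin 4 → ℝ := fun i => ![- x 3, - x 2, x 1, x 0] i / ‖x‖ ^ 2

/-- Third form of the coframe. -/
def sigma₃ (x : E4) : Fin 4 → ℝ := fun i => ![- x 1, x 0, - x 3, x 2] i / ‖x‖ ^ 2

/-- The square of a one-form. -/
def sq (a : Fin 4 → ℝ) : Matrix (Fin 4) (Fin 4) ℝ := Matrix.vecMulVec a a

/-- The metric `(1+r̂²)/(n+r̂²) dr̂² + (1+r̂²)(σ₁² + σ₂²) + r̂²(n+r̂²)/(1+r̂²) σ₃²`. -/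
def gLEB (n : ℕ) : MetricField := fun x =>
  ((1 + rhat x ^ 2) / (n + rhat x ^ 2)) • sq (drhat x) +
  (1 + rhat x ^ 2) • sq (sigma₁ x) + (1 + rhat x ^ 2) • sq (sigma₂ x) +
  (rhat x ^ 2 * (n + rhat x ^ 2) / (1 + rhat x ^ 2)) • sq (sigma₃ x)

/-- The conformal compactification `(n + r̂²)⁻² g_{LEB(n)}`. -/
def gLEBc (n : ℕ) : MetricField := fun x => (1 / (n + rhat x ^ 2) ^ 2) • gLEB n x

/-- The radial function `v = v(s)` satisfies `Δ v = -K v³` for `g_{LEB(n)}` where `0 < s < ∞`. (By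
continuity this is the same as on all of `𝒪(-n)` for a function that is smooth across `ℙ¹`.) -/
def SolvesALE (n : ℕ) (K : Orb n → ℝ) (v : ℝ → ℝ) : Prop :=
  ∀ x : E4, x ≠ 0 →
    laplacian (gLEB n) (fun y => v ‖y‖) x = - K (chartOrb n x) * v ‖x‖ ^ 3

/-- The function `u` satisfies `-Δ u + R u / 6 = K u³` for the compactified metric where
`0 < s < ∞`. (By continuity this is the same as on the whole orbifold for a smooth `u`.) -/
def SolvesConf (n : ℕ) (K u : Orb n → ℝ) : Prop :=
  ∀ x : E4, x ≠ 0 →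
    - laplacian (gLEBc n) (fun y => u (chartOrb n y)) x +
        (1 / 6) * scalarCurvature (gLEBc n) x * u (chartOrb n x) =
      K (chartOrb n x) * u (chartOrb n x) ^ 3

end LeBrun

end

noncomputable section

namespace LeBrun

open Filter Topology Set

/-! ### The radial equation -/

/-! Write v = s² f / (2s² + 1) and p = `flux f`. Both equations reduce to the same radial ODE, p' =
-K f³ s (1 + s²) / (2s² + 1)³. For the first, this is the radial Laplacian; for the second, u plays
the role of f, because the zeroth-order term produced by the rescaling cancels the scalar curvature
term (Eguchi–Hanson is scalar-flat).

The variable τ = log(2s² + 1) / 4 is harmonic for Eguchi–Hanson, and in it the ODE reads v_τ = p,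
p_τ = -K Q v³ with Q = (1 + s²)(2s² + 1) / s⁶. The Pohozaev function is 4(τ p² - v p + τ K Q v⁴ /
2), and its τ-derivative is 2 v⁴ (τ Q K_τ + K (3Q + τ Q_τ)). The first term is ≤ 0 since K is
nonincreasing. The second is negative because 3Q + τ Q_τ < 0, which is exactly `pade_lt_log` at x =
s².

So the Pohozaev function is strictly decreasing. It vanishes at s = 0 and tends to 0 as s → ∞,
because f extends smoothly across ℙ¹ (`tendsto_pohozaev`). This is a contradiction
(`no_positive_radial_solution`). The rest of the file derives the ODE from the coordinate
definitions of Laplacian and curvature. -/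

lemma pade_lt_log {x : ℝ} (hx : 0 < x) :
    12 * x * (1 + x) < Real.log (2 * x + 1) * (4 * x ^ 2 + 12 * x + 6) := by
  -- The quotient is the [2/2] Padé approximant of log(1 + 2x) at 0; it agrees with the logarithm
  -- through order 4, hence the factor y⁴ in the derivative of the difference.
  let F : ℝ → ℝ := fun x => Real.log (2 * x + 1) - 12 * x * (1 + x) / (4 * x ^ 2 + 12 * x + 6)
  have hF : ∀ y : ℝ, 0 ≤ y → HasDerivAt F
      (32 * y ^ 4 / ((2 * y + 1) * (4 * y ^ 2 + 12 * y + 6) ^ 2)) y := by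
    intro y hy
    have h1 : (2 * y + 1) ≠ 0 := by positivity
    have h2 : (4 * y ^ 2 + 12 * y + 6) ≠ 0 := by positivity
    have d1 : HasDerivAt (fun y : ℝ => 2 * y + 1) 2 y := by
      simpa using ((hasDerivAt_id y).const_mul 2).add_const 1
    have d2 : HasDerivAt (fun y : ℝ => 12 * y * (1 + y)) (12 + 24 * y) y := by
      have := ((hasDerivAt_id y).const_mul 12).mul ((hasDerivAt_id y).const_add 1)
      refine this.congr_deriv ?_
      simp only [id_eq]; ring
    have d3 : HasDerivAt (fun y : ℝ => 4 * y ^ 2 + 12 * y + 6) (8 * y + 12) y := by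
      have := ((((hasDerivAt_id y).pow 2).const_mul 4).add
        ((hasDerivAt_id y).const_mul 12)).add_const 6
      refine this.congr_deriv ?_
      simp only [id_eq, Nat.cast_ofNat]; ring
    refine ((d1.log h1).sub (d2.div d3 h2)).congr_deriv ?_
    field_simp
    ring
  have hmono : StrictMonoOn F (Ici 0) := by
    refine strictMonoOn_of_deriv_pos (convex_Ici 0)
      (fun y hy => (hF y hy).continuousAt.continuousWithinAt) ?_
    intro y hy
    rw [interior_Ici] at hy
    have hy : 0 < y := hy
    rw [(hF y hy.le).deriv]
    positivity
  have := hmono (mem_Ici.2 le_rfl) (mem_Ici.2 hx.le) hx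
  have h0 : F 0 = 0 := by simp [F]
  rw [h0] at this
  have h2 : 0 < (4 * x ^ 2 + 12 * x + 6) := by positivity
  have h3 : 12 * x * (1 + x) / (4 * x ^ 2 + 12 * x + 6) < Real.log (2 * x + 1) := by
    simpa [F] using this
  rwa [div_lt_iff₀ h2] at h3

/-- The flux `(2 s² + 1) / s · v'` of `v = s² f / (2 s² + 1)`. -/
def flux (f : ℝ → ℝ) (s : ℝ) : ℝ := 2 * f s / (2 * s ^ 2 + 1) + s * deriv f s

/-- The Pohozaev function of the radial equation. -/
def pohozaev (f K : ℝ → ℝ) (s : ℝ) : ℝ :=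
  Real.log (2 * s ^ 2 + 1) * flux f s ^ 2 - 4 * (s ^ 2 * f s / (2 * s ^ 2 + 1)) * flux f s +
    Real.log (2 * s ^ 2 + 1) * (K s * (1 + s ^ 2) * s ^ 2 * f s ^ 4 / (2 * (2 * s ^ 2 + 1) ^ 3))

lemma hasDerivAt_two_mul_sq_add_one (s : ℝ) :
    HasDerivAt (fun s : ℝ => 2 * s ^ 2 + 1) (4 * s) s := by
  have := (((hasDerivAt_id s).pow 2).const_mul 2).add_const 1
  refine this.congr_deriv ?_
  simp only [id_eq, Nat.cast_ofNat]; ring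

lemma differentiable_flux {f : ℝ → ℝ} (hf : ContDiff ℝ ∞ f) : Differentiable ℝ (flux f) := by
  have hfd : Differentiable ℝ f := hf.differentiable (by simp)
  have hfd' : Differentiable ℝ (deriv f) :=
    ((contDiff_infty_iff_deriv.1 hf).2).differentiable (by simp)
  have hne : ∀ s : ℝ, 2 * s ^ 2 + 1 ≠ 0 := fun s => by positivity
  unfold flux
  exact Differentiable.add (Differentiable.div (by fun_prop) (by fun_prop) hne) (by fun_prop)

/-- In the variable τ = log(2s² + 1) / 4 one has v_τ = p, so the p² terms cancel, and the v³ p terms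
cancel by the ODE. Only multiples of v⁴ remain, grouped here by K' and K. -/
lemma hasDerivAt_pohozaev {f K : ℝ → ℝ} {s p' K' : ℝ}
    (hf : DifferentiableAt ℝ f s) (hK : HasDerivAt K K' s) (hp : HasDerivAt (flux f) p' s)
    (hode : p' = -(K s * f s ^ 3 * s * (1 + s ^ 2) / (2 * s ^ 2 + 1) ^ 3)) :
    HasDerivAt (pohozaev f K)
      (Real.log (2 * s ^ 2 + 1) * K' * ((1 + s ^ 2) * s ^ 2 * f s ^ 4 / (2 * (2 * s ^ 2 + 1) ^ 3))
        + K s * f s ^ 4 * s / (2 * (2 * s ^ 2 + 1) ^ 4) *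
          (12 * s ^ 2 * (1 + s ^ 2)
            - Real.log (2 * s ^ 2 + 1) * (4 * (s ^ 2) ^ 2 + 12 * s ^ 2 + 6))) s := by
  have h1 : (2 * s ^ 2 + 1) ≠ 0 := by positivity
  have dE := hasDerivAt_two_mul_sq_add_one s
  have dL := dE.log h1
  have ds : HasDerivAt (fun s : ℝ => s ^ 2) (2 * s) s := by simpa using hasDerivAt_pow 2 s
  have df := hf.hasDerivAt
  have dv := (ds.mul df).div dE h1
  have h2 : 2 * (2 * s ^ 2 + 1) ^ 3 ≠ 0 := by positivity
  have dn := (((hK.mul (ds.const_add 1)).mul ds).mul (df.pow 4)).div ((dE.pow 3).const_mul 2) h2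
  have := ((dL.mul (hp.pow 2)).sub ((dv.const_mul 4).mul hp)).add (dL.mul dn)
  refine this.congr_deriv ?_
  simp only [Pi.mul_apply, Pi.pow_apply, Pi.div_apply, Nat.cast_ofNat, hode]
  have hfl : deriv f s * s = flux f s - 2 * f s / (2 * s ^ 2 + 1) := by unfold flux; ring
  generalize flux f s = p at *
  generalize Real.log (2 * s ^ 2 + 1) = l at *
  generalize deriv f s = f1 at *
  -- Eliminating the derivative of f in favour of the flux divides by s.
  by_cases hs : s = 0
  · subst hs; simp
  have hf1 : f1 = (p - 2 * f s / (2 * s ^ 2 + 1)) / s := by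
    rw [← hfl]; field_simp
  subst hf1
  field_simp
  ring

/-- With r = 1/s, regularity of φ at 0 makes the flux O(r), so the coefficient of the logarithm is
O(r²), while the logarithm itself grows only like -2 log r. One factor r is spent on the logarithm
(`hrL`), the other stays in `A`. -/
lemma tendsto_pohozaev {f K φ κ : ℝ → ℝ} (hφ : ContDiff ℝ ∞ φ) (hκ : Continuous κ)
    (hf : ∀ s, 0 < s → f s = φ (1 / s)) (hK : ∀ s, 0 < s → K s = κ (1 / s)) :
    Tendsto (fun r => pohozaev f K (1 / r)) (𝓝[>] 0) (𝓝 0) := by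
  have hφ' : Continuous (deriv φ) := hφ.continuous_deriv (by simp)
  have hφc := hφ.continuous
  let P : ℝ → ℝ := fun r => 2 * r * φ r / (2 + r ^ 2) - deriv φ r
  let A : ℝ → ℝ := fun r => r * (P r ^ 2 + κ r * φ r ^ 4 * (1 + r ^ 2) / (2 * (2 + r ^ 2) ^ 3))
  let B : ℝ → ℝ := fun r => r * (4 * (φ r / (2 + r ^ 2)) * P r)
  have hne : ∀ r : ℝ, 2 + r ^ 2 ≠ 0 := fun r => by positivity
  have hP : Continuous P := by
    refine Continuous.sub (Continuous.div (by fun_prop) (by fun_prop) hne) hφ'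
  have hA : Continuous A := by
    refine continuous_id.mul ((hP.pow 2).add (Continuous.div (by fun_prop) (by fun_prop) ?_))
    intro r; have := hne r; positivity
  have hB : Continuous B :=
    continuous_id.mul (((Continuous.div hφc (by fun_prop) hne).const_mul 4).mul hP)
  have hrL : Tendsto (fun r : ℝ => r * Real.log (2 + r ^ 2) - 2 * (Real.log r * r))
      (𝓝[>] 0) (𝓝 0) := by
    have h1 : Tendsto (fun r : ℝ => r * Real.log (2 + r ^ 2)) (𝓝[>] 0) (𝓝 0) := by
      have hc : Continuous fun r : ℝ => r * Real.log (2 + r ^ 2) :=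
        continuous_id.mul (Continuous.log (by fun_prop) hne)
      have := hc.tendsto 0
      simp only [zero_mul] at this
      exact this.mono_left nhdsWithin_le_nhds
    have h2 : Tendsto (fun r : ℝ => Real.log r * r) (𝓝[>] 0) (𝓝 0) := by
      simpa using tendsto_log_mul_rpow_nhdsGT_zero (r := 1) one_pos
    simpa using h1.sub (h2.const_mul 2)
  have hA0 : Tendsto A (𝓝[>] 0) (𝓝 0) := by
    have := hA.tendsto 0
    have h0 : A 0 = 0 := by simp [A]
    rw [h0] at this; exact this.mono_left nhdsWithin_le_nhds
  have hB0 : Tendsto B (𝓝[>] 0) (𝓝 0) := by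
    have := hB.tendsto 0
    have h0 : B 0 = 0 := by simp [B]
    rw [h0] at this; exact this.mono_left nhdsWithin_le_nhds
  have key := (hrL.mul hA0).sub hB0
  simp only [mul_zero, sub_zero] at key
  refine key.congr' ?_
  filter_upwards [self_mem_nhdsWithin] with r hr
  have hr : 0 < r := hr
  have hfr : f (1 / r) = φ r := by rw [hf _ (by positivity), one_div_one_div]
  have hKr : K (1 / r) = κ r := by rw [hK _ (by positivity), one_div_one_div]
  have hf' : deriv f (1 / r) = - (deriv φ r * r ^ 2) := by
    have e : f =ᶠ[𝓝 (1 / r)] fun s => φ (s⁻¹) := by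
      filter_upwards [lt_mem_nhds (show (0 : ℝ) < 1 / r by positivity)] with s hs
      rw [hf s hs, one_div]
    rw [e.deriv_eq]
    have d1 : HasDerivAt (fun s : ℝ => s⁻¹) (-r ^ 2) (1 / r) := by
      have := hasDerivAt_inv (x := 1 / r) (by positivity)
      refine this.congr_deriv ?_
      simp
    have d2 : HasDerivAt φ (deriv φ r) ((fun s : ℝ => s⁻¹) (1 / r)) := by
      have : (1 / r)⁻¹ = r := by field_simp
      simp only [this]
      exact ((hφ.differentiable (by simp)) r).hasDerivAt
    have := (d2.comp (1 / r) d1).deriv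
    rw [Function.comp_def] at this
    rw [this]; ring
  have hlog : Real.log (2 * (1 / r) ^ 2 + 1) = Real.log (2 + r ^ 2) - 2 * Real.log r := by
    have : 2 * (1 / r) ^ 2 + 1 = (2 + r ^ 2) / r ^ 2 := by field_simp
    rw [this, Real.log_div (hne r) (by positivity), Real.log_pow]; norm_num
  have hfl : flux f (1 / r) = r * P r := by
    simp only [flux, hfr, hf', P]
    field_simp
    ring
  unfold pohozaev
  rw [hlog, hfl, hfr, hKr]
  simp only [A, B]
  generalize P r = p
  generalize Real.log (2 + r ^ 2) = l1
  generalize Real.log r = l2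
  have := hne r
  field_simp
  ring

/-- The radial equation on `(0, ∞)` has no positive solution that extends regularly to both ends,
if `K` is positive and nonincreasing. -/
theorem no_positive_radial_solution {f K φ κ : ℝ → ℝ} (hfc : ContDiff ℝ ∞ f)
    (hKc : Differentiable ℝ K) (hφ : ContDiff ℝ ∞ φ) (hκ : Continuous κ)
    (hf : ∀ s, 0 < s → f s = φ (1 / s)) (hK : ∀ s, 0 < s → K s = κ (1 / s))
    (hf0 : ∀ s, 0 < f s) (hK0 : ∀ s, 0 < K s) (hK' : ∀ s, 0 ≤ s → deriv K s ≤ 0)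
    (hode : ∀ s, 0 < s → deriv (flux f) s =
      -(K s * f s ^ 3 * s * (1 + s ^ 2) / (2 * s ^ 2 + 1) ^ 3)) : False := by
  have hfd : Differentiable ℝ f := hfc.differentiable (by simp)
  have hne : ∀ s : ℝ, 2 * s ^ 2 + 1 ≠ 0 := fun s => by positivity
  have hfl := differentiable_flux hfc
  have hcont : Continuous (pohozaev f K) := by
    have h1 := hfd.continuous
    have h2 := hKc.continuous
    have h3 := hfl.continuous
    have h4 : Continuous fun s : ℝ => Real.log (2 * s ^ 2 + 1) :=
      Continuous.log (by fun_prop) hne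
    unfold pohozaev
    refine Continuous.add (Continuous.sub (by fun_prop) (Continuous.mul (Continuous.mul
      continuous_const (Continuous.div (by fun_prop) (by fun_prop) hne)) h3))
      (h4.mul (Continuous.div (by fun_prop) (by fun_prop) ?_))
    intro s; have := hne s; positivity
  have hanti : StrictAntiOn (pohozaev f K) (Ici 0) := by
    refine strictAntiOn_of_deriv_neg (convex_Ici 0) hcont.continuousOn ?_
    intro s hs
    rw [interior_Ici] at hs
    have hs : 0 < s := hs
    rw [(hasDerivAt_pohozaev (hfd s) (hKc s).hasDerivAt (hfl s).hasDerivAt (hode s hs)).deriv]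
    have hl : 0 ≤ Real.log (2 * s ^ 2 + 1) := Real.log_nonneg (by nlinarith)
    have hpade := pade_lt_log (show 0 < s ^ 2 by positivity)
    have hfs := hf0 s
    have hKs := hK0 s
    have a1 : Real.log (2 * s ^ 2 + 1) * deriv K s ≤ 0 :=
      mul_nonpos_of_nonneg_of_nonpos hl (hK' s hs.le)
    have a2 : 0 ≤ ((1 + s ^ 2) * s ^ 2 * f s ^ 4 / (2 * (2 * s ^ 2 + 1) ^ 3)) := by positivity
    have a3 : 0 < K s * f s ^ 4 * s / (2 * (2 * s ^ 2 + 1) ^ 4) := by positivity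
    exact add_neg_of_nonpos_of_neg (mul_nonpos_of_nonpos_of_nonneg a1 a2)
      (mul_neg_of_pos_of_neg a3 (by linarith))
  have h0 : pohozaev f K 0 = 0 := by simp [pohozaev]
  have h1 : pohozaev f K 1 < 0 := by
    rw [← h0]; exact hanti (mem_Ici.2 le_rfl) (mem_Ici.2 zero_le_one) one_pos
  have hlim := tendsto_pohozaev hφ hκ hf hK
  -- For s ≥ 1 the values stay below the negative value at 1, so they cannot tend to 0.
  have : (0 : ℝ) ≤ pohozaev f K 1 := by
    refine le_of_tendsto hlim ?_
    filter_upwards [Ioo_mem_nhdsGT (show (0 : ℝ) < 1 by norm_num)] with r hr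
    have : 1 ≤ 1 / r := by rw [le_div_iff₀ hr.1]; linarith [hr.2]
    exact hanti.antitoneOn (mem_Ici.2 zero_le_one) (mem_Ici.2 (by linarith)) this
  linarith

/-! ### Partial derivatives -/

/-- `f` is differentiable at `x` with partial derivatives `d`. -/
def HasPD (f : E4 → ℝ) (d : Fin 4 → ℝ) (x : E4) : Prop :=
  DifferentiableAt ℝ f x ∧ ∀ i, pd i f x = d i

lemma HasPD.pd_eq {f : E4 → ℝ} {d : Fin 4 → ℝ} {x : E4} (h : HasPD f d x) (i : Fin 4) :
    pd i f x = d i := h.2 i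

lemma HasPD.congr {f g : E4 → ℝ} {d : Fin 4 → ℝ} {x : E4} (h : HasPD f d x)
    (e : g =ᶠ[𝓝 x] f) : HasPD g d x :=
  ⟨h.1.congr_of_eventuallyEq e, fun i => by rw [pd, e.fderiv_eq]; exact h.2 i⟩

lemma HasPD.congr_pd {f : E4 → ℝ} {d d' : Fin 4 → ℝ} {x : E4} (h : HasPD f d x)
    (e : ∀ i, d i = d' i) : HasPD f d' x :=
  ⟨h.1, fun i => by rw [h.2 i, e i]⟩

lemma hasPD_const (c : ℝ) (x : E4) : HasPD (fun _ => c) (fun _ => 0) x :=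
  ⟨differentiableAt_const c, fun i => by simp [pd]⟩

lemma HasPD.add {f g : E4 → ℝ} {d e : Fin 4 → ℝ} {x : E4} (hf : HasPD f d x)
    (hg : HasPD g e x) : HasPD (fun y => f y + g y) (fun i => d i + e i) x :=
  ⟨hf.1.add hg.1, fun i => by
    rw [pd, fderiv_fun_add hf.1 hg.1]
    exact congrArg₂ (· + ·) (hf.2 i) (hg.2 i)⟩

lemma HasPD.mul {f g : E4 → ℝ} {d e : Fin 4 → ℝ} {x : E4} (hf : HasPD f d x)
    (hg : HasPD g e x) :
    HasPD (fun y => f y * g y) (fun i => d i * g x + f x * e i) x :=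
  ⟨hf.1.mul hg.1, fun i => by
    have h1 := hf.2 i
    have h2 := hg.2 i
    rw [pd] at h1 h2
    rw [pd, fderiv_fun_mul hf.1 hg.1]
    simp [h1, h2]; ring⟩

lemma HasPD.sum {ι : Type*} (s : Finset ι) {f : ι → E4 → ℝ} {d : ι → Fin 4 → ℝ} {x : E4}
    (hf : ∀ k ∈ s, HasPD (f k) (d k) x) :
    HasPD (fun y => ∑ k ∈ s, f k y) (fun i => ∑ k ∈ s, d k i) x := by
  classical
  induction s using Finset.induction_on with
  | empty => simpa using hasPD_const 0 x
  | insert a s ha ih =>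
    simp only [Finset.sum_insert ha]
    exact (hf a (Finset.mem_insert_self a s)).add
      (ih fun k hk => hf k (Finset.mem_insert_of_mem hk))

lemma hasPD_coord (k : Fin 4) (x : E4) :
    HasPD (fun y => y k) (fun i => if k = i then 1 else 0) x := by
  have h : HasFDerivAt (fun y : E4 => y k) (EuclideanSpace.proj k : E4 →L[ℝ] ℝ) x :=
    (EuclideanSpace.proj k : E4 →L[ℝ] ℝ).hasFDerivAt
  refine ⟨h.differentiableAt, fun i => ?_⟩
  rw [pd, h.fderiv]
  simp

lemma norm_sq_eq (x : E4) : ‖x‖ ^ 2 = x 0 ^ 2 + x 1 ^ 2 + x 2 ^ 2 + x 3 ^ 2 := by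
  rw [EuclideanSpace.real_norm_sq_eq, Fin.sum_univ_four]

lemma sum_mul_self_eq (x : E4) : ∑ i, x i * x i = ‖x‖ ^ 2 := by
  rw [norm_sq_eq, Fin.sum_univ_four]; ring

lemma hasPD_comp {c : ℝ → ℝ} {g : E4 → ℝ} {c' : ℝ} {d : Fin 4 → ℝ} {x : E4}
    (hc : HasDerivAt c c' (g x)) (hg : HasPD g d x) :
    HasPD (fun y => c (g y)) (fun i => c' * d i) x := by
  have h := hc.comp_hasFDerivAt x hg.1.hasFDerivAt
  refine ⟨h.differentiableAt, fun i => ?_⟩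
  have e := h.fderiv
  simp only [Function.comp_def] at e
  have h1 := hg.2 i
  rw [pd] at h1
  rw [pd, e]
  simp [h1]

lemma hasPD_normSq (x : E4) : HasPD (fun y => ‖y‖ ^ 2) (fun i => 2 * x i) x := by
  have h := HasPD.sum Finset.univ fun k _ => (hasPD_coord k x).mul (hasPD_coord k x)
  refine (h.congr (Eventually.of_forall fun y => (sum_mul_self_eq y).symm)).congr_pd fun i => ?_
  simp [Finset.sum_add_distrib, two_mul]

lemma hasPD_norm {x : E4} (hx : x ≠ 0) : HasPD (fun y => ‖y‖) (fun i => x i / ‖x‖) x := by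
  have hn : 0 < ‖x‖ := norm_pos_iff.2 hx
  have h := hasPD_comp (g := fun y => ‖y‖ ^ 2)
    (Real.hasDerivAt_sqrt (by positivity : ‖x‖ ^ 2 ≠ 0)) (hasPD_normSq x)
  refine (h.congr (Eventually.of_forall fun y => ?_)).congr_pd fun i => ?_
  · simp
  · rw [Real.sqrt_sq hn.le]; field_simp

/-- The Laplacian of a radial function, for a metric for which the radial direction is an
eigendirection. -/
lemma laplacian_radial {g : MetricField} {D e F : ℝ → ℝ} {W' : ℝ} {x : E4} (hx : x ≠ 0)
    (hD : ∀ y : E4, y ≠ 0 → √(g y).det = D ‖y‖)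
    (he : ∀ y : E4, y ≠ 0 → ∀ i, ∑ j, (g y)⁻¹ i j * y j = e ‖y‖ * y i)
    (hF : ∀ s, 0 < s → DifferentiableAt ℝ F s)
    (hW : HasDerivAt (fun s => D s * (e s * (deriv F s / s))) W' ‖x‖) :
    laplacian g (fun y => F ‖y‖) x =
      (D ‖x‖)⁻¹ * (4 * (D ‖x‖ * (e ‖x‖ * (deriv F ‖x‖ / ‖x‖))) + ‖x‖ * W') := by
  have hn : 0 < ‖x‖ := norm_pos_iff.2 hx
  -- The weighted gradient is W(‖y‖) y with W = D e F'/s, and the divergence of such a field in ℝ⁴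
  -- is 4W + ‖x‖ W'.
  have key : ∀ i : Fin 4, pd i (fun y => √(g y).det * ∑ j, (g y)⁻¹ i j *
      pd j (fun y => F ‖y‖) y) x =
      W' * (x i / ‖x‖) * x i + D ‖x‖ * (e ‖x‖ * (deriv F ‖x‖ / ‖x‖)) := by
    intro i
    have h := (hasPD_comp hW (hasPD_norm hx)).mul (hasPD_coord i x)
    have h2 := (h.congr (g := fun y => √(g y).det * ∑ j, (g y)⁻¹ i j *
      pd j (fun y => F ‖y‖) y) ?_).pd_eq i
    · rw [h2]; simp
    filter_upwards [isOpen_ne.mem_nhds hx] with y hy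
    have hy' : 0 < ‖y‖ := norm_pos_iff.2 hy
    have hpd : ∀ j, pd j (fun y => F ‖y‖) y = (deriv F ‖y‖ / ‖y‖) * y j := fun j => by
      rw [(hasPD_comp (hF _ hy').hasDerivAt (hasPD_norm hy)).pd_eq j]; ring
    simp only [hpd]
    rw [hD y hy]
    have : ∀ j, (g y)⁻¹ i j * (deriv F ‖y‖ / ‖y‖ * y j) =
        (deriv F ‖y‖ / ‖y‖) * ((g y)⁻¹ i j * y j) := fun j => by ring
    rw [Finset.sum_congr rfl fun j _ => this j, ← Finset.mul_sum, he y hy i]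
    ring
  unfold laplacian
  rw [hD x hx, Finset.sum_congr rfl fun i _ => key i, Finset.sum_add_distrib]
  have : ∀ i, W' * (x i / ‖x‖) * x i = (W' / ‖x‖) * (x i * x i) := fun i => by ring
  rw [Finset.sum_congr rfl fun i _ => this i, ← Finset.mul_sum, sum_mul_self_eq]
  simp only [Finset.sum_const, Finset.card_univ, Fintype.card_fin, nsmul_eq_mul]
  push_cast
  field_simp
  ring

/-! ### The orthogonal frame -/

/-- The rows are the radial direction, two horizontal directions, and the Hopf direction, each of
length `‖x‖`. -/
def frame (x : E4) : Matrix (Fin 4) (Fin 4) ℝ :=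
  ![![x 0, x 1, x 2, x 3], ![- x 2, x 3, x 0, - x 1], ![- x 3, - x 2, x 1, x 0],
    ![- x 1, x 0, - x 3, x 2]]

lemma frame_mul_transpose (x : E4) : frame x * (frame x)ᵀ = ‖x‖ ^ 2 • 1 := by
  ext i j
  rw [norm_sq_eq]
  simp only [Matrix.mul_apply, Fin.sum_univ_four, Matrix.transpose_apply]
  fin_cases i <;> fin_cases j <;> simp [frame] <;> ring

lemma transpose_mul_frame (x : E4) : (frame x)ᵀ * frame x = ‖x‖ ^ 2 • 1 := by
  ext i j
  rw [norm_sq_eq]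
  simp only [Matrix.mul_apply, Fin.sum_univ_four, Matrix.transpose_apply]
  fin_cases i <;> fin_cases j <;> simp [frame] <;> ring

/-- The metric with squared lengths `a, b, b, c` on the dual frame. -/
def frameMetric (a b c : ℝ) (x : E4) : Matrix (Fin 4) (Fin 4) ℝ :=
  (frame x)ᵀ * Matrix.diagonal ![a, b, b, c] * frame x

/-- Only the square of the determinant of the frame enters, and it is ‖x‖⁸, so no sign has to be
determined. -/
lemma det_frameMetric (a b c : ℝ) (x : E4) :
    (frameMetric a b c x).det = a * c * (b * ‖x‖ ^ 4) ^ 2 := by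
  have h := congrArg Matrix.det (frame_mul_transpose x)
  rw [Matrix.det_mul, Matrix.det_transpose, Matrix.det_smul, Matrix.det_one] at h
  simp at h
  rw [frameMetric, Matrix.det_mul, Matrix.det_mul, Matrix.det_transpose, Matrix.det_diagonal,
    Fin.prod_univ_four]
  simp
  linear_combination (a * c * b ^ 2) * h

/-- The frame is ‖x‖ times an orthogonal matrix. -/
lemma frameMetric_inv {a b c : ℝ} (ha : a ≠ 0) (hb : b ≠ 0) (hc : c ≠ 0) {x : E4} (hx : x ≠ 0) :
    (frameMetric a b c x)⁻¹ = ((‖x‖ ^ 4)⁻¹) • frameMetric a⁻¹ b⁻¹ c⁻¹ x := by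
  have hn : 0 < ‖x‖ := norm_pos_iff.2 hx
  refine Matrix.inv_eq_right_inv ?_
  have hd : Matrix.diagonal ![a, b, b, c] * Matrix.diagonal ![a⁻¹, b⁻¹, b⁻¹, c⁻¹] = 1 := by
    rw [Matrix.diagonal_mul_diagonal, ← Matrix.diagonal_one]
    congr 1; ext i; fin_cases i <;> simp [ha, hb, hc]
  unfold frameMetric
  calc _ = (‖x‖ ^ 4)⁻¹ • ((frame x)ᵀ * (Matrix.diagonal ![a, b, b, c] *
        (frame x * (frame x)ᵀ) * Matrix.diagonal ![a⁻¹, b⁻¹, b⁻¹, c⁻¹]) * frame x) := by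
        rw [Matrix.mul_smul]; simp only [Matrix.mul_assoc]
    _ = _ := by
        rw [frame_mul_transpose, Matrix.mul_smul, Matrix.smul_mul, Matrix.mul_one, hd,
          Matrix.mul_smul, Matrix.smul_mul, Matrix.mul_one, transpose_mul_frame, smul_smul,
          smul_smul]
        rw [show (‖x‖ ^ 4)⁻¹ * ‖x‖ ^ 2 * ‖x‖ ^ 2 = 1 by field_simp, one_smul]

lemma frameMetric_apply (a b c : ℝ) (x : E4) (i j : Fin 4) :
    frameMetric a b c x i j = a * (frame x 0 i * frame x 0 j) +
      b * (frame x 1 i * frame x 1 j + frame x 2 i * frame x 2 j) +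
      c * (frame x 3 i * frame x 3 j) := by
  simp [frameMetric, Matrix.mul_apply, Fin.sum_univ_four]
  ring

lemma frameMetric_mulVec (a b c : ℝ) (x : E4) (i : Fin 4) :
    ∑ j, frameMetric a b c x i j * x j = a * ‖x‖ ^ 2 * x i := by
  simp only [frameMetric_apply, Fin.sum_univ_four, norm_sq_eq]
  fin_cases i <;> simp [frame] <;> ring

lemma frameMetric_inv_mulVec {a b c : ℝ} (ha : a ≠ 0) (hb : b ≠ 0) (hc : c ≠ 0) {x : E4}
    (hx : x ≠ 0) (i : Fin 4) :
    ∑ j, (frameMetric a b c x)⁻¹ i j * x j = (a * ‖x‖ ^ 2)⁻¹ * x i := by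
  have hn : 0 < ‖x‖ := norm_pos_iff.2 hx
  rw [frameMetric_inv ha hb hc hx]
  simp only [Matrix.smul_apply, smul_eq_mul, mul_assoc]
  rw [← Finset.mul_sum, frameMetric_mulVec]
  field_simp

/-! ### The LeBrun metrics in the orthogonal frame and their radial Laplacians. -/

lemma gLEB_eq_frameMetric (n : ℕ) {x : E4} (hx : x ≠ 0) :
    gLEB n x = frameMetric ((‖x‖ ^ 2 + 1) / ((n * ‖x‖ ^ 2 + 1) * ‖x‖ ^ 6))
      ((‖x‖ ^ 2 + 1) / ‖x‖ ^ 6)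
      ((n * ‖x‖ ^ 2 + 1) / ((‖x‖ ^ 2 + 1) * ‖x‖ ^ 6)) x := by
  have hn : 0 < ‖x‖ := norm_pos_iff.2 hx
  have f0 : ∀ i, frame x 0 i = x i := fun i => by fin_cases i <;> rfl
  ext i j
  rw [frameMetric_apply]
  simp only [gLEB, sq, Matrix.add_apply, Matrix.smul_apply, Matrix.vecMulVec_apply, smul_eq_mul,
    drhat, sigma₁, sigma₂, sigma₃, rhat, f0]
  simp only [frame, Matrix.cons_val]
  generalize ![- x 2, x 3, x 0, - x 1] i = p
  generalize ![- x 2, x 3, x 0, - x 1] j = p'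
  generalize ![- x 3, - x 2, x 1, x 0] i = q
  generalize ![- x 3, - x 2, x 1, x 0] j = q'
  generalize ![- x 1, x 0, - x 3, x 2] i = r
  generalize ![- x 1, x 0, - x 3, x 2] j = r'
  field_simp
  ring

lemma gLEBc_eq_frameMetric (n : ℕ) {x : E4} (hx : x ≠ 0) :
    gLEBc n x = frameMetric ((‖x‖ ^ 2 + 1) / ((n * ‖x‖ ^ 2 + 1) ^ 3 * ‖x‖ ^ 2))
      ((‖x‖ ^ 2 + 1) / ((n * ‖x‖ ^ 2 + 1) ^ 2 * ‖x‖ ^ 2))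
      (1 / ((‖x‖ ^ 2 + 1) * (n * ‖x‖ ^ 2 + 1) * ‖x‖ ^ 2)) x := by
  have hn : 0 < ‖x‖ := norm_pos_iff.2 hx
  ext i j
  rw [gLEBc, gLEB_eq_frameMetric n hx, Matrix.smul_apply, frameMetric_apply, frameMetric_apply,
    smul_eq_mul, rhat]
  field_simp

/-- The Laplacian of `g_{LEB(n)}` on radial functions. -/
lemma laplacian_gLEB (n : ℕ) {F : ℝ → ℝ} {x : E4} (hx : x ≠ 0)
    (hF : ∀ s, 0 < s → DifferentiableAt ℝ F s) {W' : ℝ}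
    (hW : HasDerivAt (fun s : ℝ => (n * s ^ 2 + 1) / s * deriv F s) W' ‖x‖) :
    laplacian (gLEB n) (fun y => F ‖y‖) x = ‖x‖ ^ 5 / (‖x‖ ^ 2 + 1) * W' := by
  have hn : 0 < ‖x‖ := norm_pos_iff.2 hx
  -- The function in `hW` is s⁴ W, with W the function required by `laplacian_radial`; the
  -- expression becomes one derivative because 4W + s W' = s⁻³ (s⁴ W)'.
  have h4 := hW.mul ((hasDerivAt_pow 4 ‖x‖).inv (by positivity))
  rw [laplacian_radial (g := gLEB n) (D := fun s => (s ^ 2 + 1) / s ^ 8)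
    (e := fun s => (n * s ^ 2 + 1) * s ^ 4 / (s ^ 2 + 1)) hx ?_ ?_ hF
    (h4.congr_of_eventuallyEq ?_)]
  · simp
    field_simp
    ring
  · intro y hy
    have hy' : 0 < ‖y‖ := norm_pos_iff.2 hy
    rw [gLEB_eq_frameMetric n hy, det_frameMetric, Real.sqrt_eq_iff_mul_self_eq (by positivity)
      (by positivity)]
    field_simp
  · intro y hy i
    have hy' : 0 < ‖y‖ := norm_pos_iff.2 hy
    rw [gLEB_eq_frameMetric n hy, frameMetric_inv_mulVec (by positivity) (by positivity)
      (by positivity) hy]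
    field_simp
  · filter_upwards [lt_mem_nhds hn] with s hs
    simp
    field_simp

/-- The Laplacian of the compactified metric on radial functions. -/
lemma laplacian_gLEBc (n : ℕ) {F : ℝ → ℝ} {x : E4} (hx : x ≠ 0)
    (hF : ∀ s, 0 < s → DifferentiableAt ℝ F s) {W' : ℝ}
    (hW : HasDerivAt (fun s : ℝ => s ^ 3 / (n * s ^ 2 + 1) * deriv F s) W' ‖x‖) :
    laplacian (gLEBc n) (fun y => F ‖y‖) x =
      (n * ‖x‖ ^ 2 + 1) ^ 4 / (‖x‖ ^ 3 * (‖x‖ ^ 2 + 1)) * W' := by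
  have hn : 0 < ‖x‖ := norm_pos_iff.2 hx
  have h4 := hW.mul ((hasDerivAt_pow 4 ‖x‖).inv (by positivity))
  rw [laplacian_radial (g := gLEBc n) (D := fun s => (s ^ 2 + 1) / (n * s ^ 2 + 1) ^ 4)
    (e := fun s => (n * s ^ 2 + 1) ^ 3 / (s ^ 2 + 1)) hx ?_ ?_ hF
    (h4.congr_of_eventuallyEq ?_)]
  · simp
    field_simp
    ring
  · intro y hy
    have hy' : 0 < ‖y‖ := norm_pos_iff.2 hy
    rw [gLEBc_eq_frameMetric n hy, det_frameMetric, Real.sqrt_eq_iff_mul_self_eq (by positivity)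
      (by positivity)]
    field_simp
  · intro y hy i
    have hy' : 0 < ‖y‖ := norm_pos_iff.2 hy
    rw [gLEBc_eq_frameMetric n hy, frameMetric_inv_mulVec (by positivity) (by positivity)
      (by positivity) hy]
    field_simp
  · filter_upwards [lt_mem_nhds hn] with s hs
    simp
    field_simp

/-! ### The scalar curvature of the compactified Eguchi-Hanson metric -/

/-- Kronecker delta. -/
def kd (i j : Fin 4) : ℝ := if i = j then 1 else 0

lemma kd_comm (i j : Fin 4) : kd i j = kd j i := by simp [kd, eq_comm]

/-- The complex structure of `ℂ²`. -/
def jm : Fin 4 → Fin 4 → ℝ :=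
  ![![0, -1, 0, 0], ![1, 0, 0, 0], ![0, 0, 0, -1], ![0, 0, 1, 0]]

lemma jm_antisymm (i j : Fin 4) : jm i j = - jm j i := by
  fin_cases i <;> fin_cases j <;> simp [jm]

lemma hasPD_coord_kd (k : Fin 4) (x : E4) : HasPD (fun y => y k) (fun i => kd k i) x :=
  hasPD_coord k x

lemma hasPD_hopf (k : Fin 4) (x : E4) : HasPD (fun y => frame y 3 k) (fun i => jm k i) x := by
  have h := HasPD.sum Finset.univ fun m _ => (hasPD_const (jm k m) x).mul (hasPD_coord_kd m x)
  refine (h.congr (Eventually.of_forall fun y => ?_)).congr_pd fun i => ?_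
  · fin_cases k <;> simp [frame, jm, Fin.sum_univ_four]
  · simp [kd]

lemma sum_coord_mul_hopf (x : E4) : ∑ m, x m * frame x 3 m = 0 := by
  simp [Fin.sum_univ_four, frame]; ring

lemma sum_hopf_mul_self (x : E4) : ∑ m, frame x 3 m * frame x 3 m = ‖x‖ ^ 2 := by
  simp [Fin.sum_univ_four, frame, norm_sq_eq]; ring

lemma sum_coord_mul_jm (x : E4) (i : Fin 4) : ∑ m, x m * jm m i = - frame x 3 i := by
  fin_cases i <;> simp [Fin.sum_univ_four, frame, jm]

lemma sum_hopf_mul_jm (x : E4) (i : Fin 4) : ∑ m, frame x 3 m * jm m i = x i := by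
  fin_cases i <;> simp [Fin.sum_univ_four, frame, jm]

/-- A `U(2)`-invariant symmetric form. -/
def invForm (a b c : ℝ) (x : E4) (i j : Fin 4) : ℝ :=
  a * kd i j + b * (x i * x j) + c * (frame x 3 i * frame x 3 j)

/-- The general `U(2)`-invariant candidate for the Christoffel symbols. -/
def invChr (c : Fin 6 → ℝ) (x : E4) (k i j : Fin 4) : ℝ :=
  c 0 * (kd i j * x k) + c 1 * (x i * x j * x k) + c 2 * (x i * kd k j + x j * kd k i) +
  c 3 * (frame x 3 i * frame x 3 j * x k) +
  c 4 * ((x i * frame x 3 j + x j * frame x 3 i) * frame x 3 k) +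
  c 5 * (jm k i * frame x 3 j + jm k j * frame x 3 i)

/-- Derivative of `invForm` in the direction `l`; `a', b', c'` are the derivatives of the
coefficients with respect to `‖x‖²`. -/
def dInvForm (a' b c b' c' : ℝ) (x : E4) (l i j : Fin 4) : ℝ :=
  a' * (2 * x l) * kd i j + b' * (2 * x l) * (x i * x j) +
  b * (kd i l * x j + x i * kd j l) + c' * (2 * x l) * (frame x 3 i * frame x 3 j) +
  c * (jm i l * frame x 3 j + frame x 3 i * jm j l)

lemma hasPD_invForm {a b c : ℝ → ℝ} {a' b' c' : ℝ} {x : E4}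
    (ha : HasDerivAt a a' (‖x‖ ^ 2)) (hb : HasDerivAt b b' (‖x‖ ^ 2))
    (hc : HasDerivAt c c' (‖x‖ ^ 2)) (i j : Fin 4) :
    HasPD (fun y => invForm (a (‖y‖ ^ 2)) (b (‖y‖ ^ 2)) (c (‖y‖ ^ 2)) y i j)
      (fun l => dInvForm a' (b (‖x‖ ^ 2)) (c (‖x‖ ^ 2)) b' c' x l i j) x := by
  have ha := hasPD_comp (g := fun y => ‖y‖ ^ 2) ha (hasPD_normSq x)
  have hb := hasPD_comp (g := fun y => ‖y‖ ^ 2) hb (hasPD_normSq x)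
  have hc := hasPD_comp (g := fun y => ‖y‖ ^ 2) hc (hasPD_normSq x)
  refine (((ha.mul (hasPD_const (kd i j) x)).add
    (hb.mul ((hasPD_coord_kd i x).mul (hasPD_coord_kd j x)))).add
    (hc.mul ((hasPD_hopf i x).mul (hasPD_hopf j x)))).congr_pd fun l => ?_
  unfold dInvForm
  ring

/-- Derivative of `invChr` in the direction `m`; `d` are the derivatives of the coefficients with
respect to `‖x‖²`. -/
def dInvChr (c d : Fin 6 → ℝ) (x : E4) (m k i j : Fin 4) : ℝ :=
  2 * x m * invChr d x k i j +
  (c 0 * (kd i j * kd k m) +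
  c 1 * (kd i m * x j * x k + x i * kd j m * x k + x i * x j * kd k m) +
  c 2 * (kd i m * kd k j + kd j m * kd k i) +
  c 3 * (jm i m * frame x 3 j * x k + frame x 3 i * jm j m * x k +
    frame x 3 i * frame x 3 j * kd k m) +
  c 4 * ((kd i m * frame x 3 j + x i * jm j m + (kd j m * frame x 3 i + x j * jm i m)) *
    frame x 3 k + (x i * frame x 3 j + x j * frame x 3 i) * jm k m) +
  c 5 * (jm k i * jm j m + jm k j * jm i m))

lemma hasPD_invChr {c : Fin 6 → ℝ → ℝ} {d : Fin 6 → ℝ} {x : E4}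
    (h : ∀ r, HasDerivAt (c r) (d r) (‖x‖ ^ 2)) (k i j : Fin 4) :
    HasPD (fun y => invChr (fun r => c r (‖y‖ ^ 2)) y k i j)
      (fun m => dInvChr (fun r => c r (‖x‖ ^ 2)) d x m k i j) x := by
  have hc := fun r => hasPD_comp (g := fun y => ‖y‖ ^ 2) (h r) (hasPD_normSq x)
  have X := fun i => hasPD_coord_kd i x
  have J := fun i => hasPD_hopf i x
  have C := fun r => hasPD_const r x
  refine (((((((hc 0).mul ((C (kd i j)).mul (X k))).add
    ((hc 1).mul (((X i).mul (X j)).mul (X k)))).add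
    ((hc 2).mul (((X i).mul (C (kd k j))).add ((X j).mul (C (kd k i)))))).add
    ((hc 3).mul (((J i).mul (J j)).mul (X k)))).add
    ((hc 4).mul ((((X i).mul (J j)).add ((X j).mul (J i))).mul (J k)))).add
    ((hc 5).mul (((C (jm k i)).mul (J j)).add ((C (jm k j)).mul (J i))))).congr_pd fun m => ?_
  unfold dInvChr invChr
  ring

lemma sum_mul_kd (f : Fin 4 → ℝ) (j : Fin 4) : ∑ m, f m * kd m j = f j := by simp [kd]

lemma sum_coord_mul_invChr (c : Fin 6 → ℝ) (x : E4) (i j : Fin 4) :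
    ∑ m, x m * invChr c x m i j = c 0 * kd i j * ‖x‖ ^ 2 + c 1 * (x i * x j) * ‖x‖ ^ 2 +
      2 * c 2 * (x i * x j) + c 3 * (frame x 3 i * frame x 3 j) * ‖x‖ ^ 2 -
      2 * c 5 * (frame x 3 i * frame x 3 j) := by
  have e : ∀ m, x m * invChr c x m i j = (c 0 * kd i j + c 1 * (x i * x j) +
      c 3 * (frame x 3 i * frame x 3 j)) * (x m * x m) +
      c 2 * (x i * (x m * kd m j) + x j * (x m * kd m i)) +
      c 4 * (x i * frame x 3 j + x j * frame x 3 i) * (x m * frame x 3 m) +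
      c 5 * (frame x 3 j * (x m * jm m i) + frame x 3 i * (x m * jm m j)) := fun m => by
    unfold invChr; ring
  simp only [e, Finset.sum_add_distrib, ← Finset.mul_sum, sum_mul_self_eq, sum_coord_mul_hopf,
    sum_coord_mul_jm, sum_mul_kd]
  ring

lemma sum_hopf_mul_invChr (c : Fin 6 → ℝ) (x : E4) (i j : Fin 4) :
    ∑ m, frame x 3 m * invChr c x m i j =
      (c 2 + c 4 * ‖x‖ ^ 2 + c 5) * (x i * frame x 3 j + x j * frame x 3 i) := by
  have e : ∀ m, frame x 3 m * invChr c x m i j = (c 0 * kd i j + c 1 * (x i * x j) +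
      c 3 * (frame x 3 i * frame x 3 j)) * (x m * frame x 3 m) +
      c 2 * (x i * (frame x 3 m * kd m j) + x j * (frame x 3 m * kd m i)) +
      c 4 * (x i * frame x 3 j + x j * frame x 3 i) * (frame x 3 m * frame x 3 m) +
      c 5 * (frame x 3 j * (frame x 3 m * jm m i) + frame x 3 i * (frame x 3 m * jm m j)) :=
    fun m => by unfold invChr; ring
  simp only [e, Finset.sum_add_distrib, ← Finset.mul_sum, sum_hopf_mul_self, sum_coord_mul_hopf,
    sum_hopf_mul_jm, sum_mul_kd]
  ring

/-- Both sides are combinations of the same six invariant tensors, and `h0`–`h5` equate their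
coefficients. The system is triangular: `h0`, `h2`, `h5` fix `e 0`, `e 2`, `e 5`, and the other
three then follow. -/
lemma dInvForm_eq_invChr {a b c a' b' c' : ℝ} {e : Fin 6 → ℝ} {x : E4}
    (h0 : e 0 * (a + b * ‖x‖ ^ 2) = b - a')
    (h1 : e 1 * (a + b * ‖x‖ ^ 2) + 2 * b * e 2 = b')
    (h2 : e 2 * a = a')
    (h3 : e 3 * (a + b * ‖x‖ ^ 2) - 2 * b * e 5 = - c')
    (h4 : e 4 * (a + c * ‖x‖ ^ 2) + c * e 2 + c * e 5 = c')
    (h5 : e 5 * a = c) (l i j : Fin 4) :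
    dInvForm a' b c b' c' x i j l + dInvForm a' b c b' c' x j i l - dInvForm a' b c b' c' x l i j =
      2 * ∑ m, invForm a b c x l m * invChr e x m i j := by
  have hs : ∑ m, invForm a b c x l m * invChr e x m i j = a * invChr e x l i j +
      b * x l * ∑ m, x m * invChr e x m i j +
      c * frame x 3 l * ∑ m, frame x 3 m * invChr e x m i j := by
    have e : ∀ m, invForm a b c x l m * invChr e x m i j = a * (kd l m * invChr e x m i j) +
      b * x l * (x m * invChr e x m i j) + c * frame x 3 l * (frame x 3 m * invChr e x m i j) :=
      fun m => by unfold invForm; ring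
    simp only [e, Finset.sum_add_distrib, ← Finset.mul_sum]
    simp [kd]
  rw [hs, sum_coord_mul_invChr, sum_hopf_mul_invChr]
  unfold dInvForm invChr
  rw [kd_comm j l, kd_comm j i, kd_comm i l, jm_antisymm j i, jm_antisymm i l, jm_antisymm j l]
  generalize frame x 3 i = Ji
  generalize frame x 3 j = Jj
  generalize frame x 3 l = Jl
  linear_combination (-2 * kd i j * x l) * h0 - 2 * x i * x j * x l * h1
    - 2 * (x i * kd l j + x j * kd l i) * h2 - 2 * Ji * Jj * x l * h3
    - 2 * (x i * Jj + x j * Ji) * Jl * h4 - 2 * (jm l i * Jj + jm l j * Ji) * h5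

/-- A candidate can be checked with its upper index lowered, which keeps the inverse metric out of
the computation. -/
lemma christoffel_eq_of_lower {g : MetricField} {x : E4} {T : Fin 4 → ℝ} {i j : Fin 4}
    (hdet : IsUnit (g x).det)
    (h : ∀ l, pd i (fun y => g y j l) x + pd j (fun y => g y i l) x - pd l (fun y => g y i j) x =
      2 * ∑ m, g x l m * T m) (k : Fin 4) : christoffel g k i j x = T k := by
  unfold christoffel
  simp only [h]
  have h1 : (g x)⁻¹ *ᵥ (g x *ᵥ T) = T := by
    rw [Matrix.mulVec_mulVec, Matrix.nonsing_inv_mul _ hdet, Matrix.one_mulVec]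
  have h2 := congrFun h1 k
  simp only [Matrix.mulVec, dotProduct] at h2
  rw [← h2, Finset.mul_sum]
  exact Finset.sum_congr rfl fun l _ => by ring

/-- Coefficients of the Christoffel symbols of the compactified Eguchi-Hanson metric, as functions
of `‖x‖²`. -/
def ehCoef : Fin 6 → ℝ → ℝ :=
  ![fun t => 1 / (t + 1), fun t => -2 / ((2 * t + 1) * (t + 1)),
    fun t => -(2 * t + 3) / ((2 * t + 1) * (t + 1)), fun t => (2 * t + 1) / (t + 1) ^ 3,
    fun t => -1 / ((2 * t + 1) * (t + 1) ^ 2), fun t => -t / (t + 1) ^ 2]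

/-- Derivatives of the functions `ehCoef`. -/
def ehCoef' : Fin 6 → ℝ → ℝ :=
  ![fun t => -1 / (t + 1) ^ 2, fun t => 2 * (4 * t + 3) / ((2 * t + 1) * (t + 1)) ^ 2,
    fun t => (4 * t ^ 2 + 12 * t + 7) / ((2 * t + 1) * (t + 1)) ^ 2,
    fun t => -(4 * t + 1) / (t + 1) ^ 4,
    fun t => (6 * t + 4) / ((2 * t + 1) ^ 2 * (t + 1) ^ 3), fun t => (t - 1) / (t + 1) ^ 3]

lemma hasDerivAt_ehCoef (r : Fin 6) {t : ℝ} (ht : 0 ≤ t) :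
    HasDerivAt (ehCoef r) (ehCoef' r t) t := by
  have hE : 2 * t + 1 ≠ 0 := by positivity
  have hF : t + 1 ≠ 0 := by positivity
  have dE : HasDerivAt (fun t : ℝ => 2 * t + 1) 2 t := by
    simpa using ((hasDerivAt_id t).const_mul 2).add_const 1
  have dF : HasDerivAt (fun t : ℝ => t + 1) 1 t := (hasDerivAt_id t).add_const 1
  have dG : HasDerivAt (fun t : ℝ => 2 * t + 3) 2 t := by
    simpa using ((hasDerivAt_id t).const_mul 2).add_const 3
  fin_cases r
  · refine ((hasDerivAt_const t (1 : ℝ)).div dF hF).congr_deriv ?_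
    simp [ehCoef']
  · refine ((hasDerivAt_const t (-2 : ℝ)).div (dE.mul dF) (mul_ne_zero hE hF)).congr_deriv ?_
    simp [ehCoef']
    field_simp
    ring
  · refine (dG.neg.div (dE.mul dF) (mul_ne_zero hE hF)).congr_deriv ?_
    simp [ehCoef']
    field_simp
    ring
  · refine (dE.div (dF.pow 3) (pow_ne_zero 3 hF)).congr_deriv ?_
    simp [ehCoef']
    field_simp
    ring
  · refine ((hasDerivAt_const t (-1 : ℝ)).div (dE.mul (dF.pow 2))
      (mul_ne_zero hE (pow_ne_zero 2 hF))).congr_deriv ?_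
    simp [ehCoef']
    field_simp
    ring
  · refine ((hasDerivAt_id t).neg.div (dF.pow 2) (pow_ne_zero 2 hF)).congr_deriv ?_
    simp [ehCoef']
    field_simp
    ring

lemma frame_zero (x : E4) (i : Fin 4) : frame x 0 i = x i := by fin_cases i <;> rfl

/-- The two horizontal squares are replaced by ‖x‖² δ minus the radial and Hopf squares, so only x
and the Hopf field remain to be differentiated. -/
lemma gLEBc_two_apply {x : E4} (hx : x ≠ 0) (i j : Fin 4) :
    gLEBc 2 x i j = invForm ((‖x‖ ^ 2 + 1) / (2 * ‖x‖ ^ 2 + 1) ^ 2)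
      (-2 * (‖x‖ ^ 2 + 1) / (2 * ‖x‖ ^ 2 + 1) ^ 3)
      (-‖x‖ ^ 2 / ((2 * ‖x‖ ^ 2 + 1) ^ 2 * (‖x‖ ^ 2 + 1))) x i j := by
  have hn : 0 < ‖x‖ := norm_pos_iff.2 hx
  have h := congrFun (congrFun (transpose_mul_frame x) i) j
  simp only [Matrix.mul_apply, Fin.sum_univ_four, Matrix.transpose_apply, Matrix.smul_apply,
    Matrix.one_apply, smul_eq_mul] at h
  have h' : frame x 1 i * frame x 1 j + frame x 2 i * frame x 2 j =
      ‖x‖ ^ 2 * kd i j - x i * x j - frame x 3 i * frame x 3 j := by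
    rw [kd, ← h, frame_zero, frame_zero]; ring
  rw [gLEBc_eq_frameMetric 2 hx, frameMetric_apply, h', invForm, frame_zero, frame_zero]
  push_cast
  field_simp
  ring

lemma isUnit_det_gLEBc (n : ℕ) {x : E4} (hx : x ≠ 0) : IsUnit (gLEBc n x).det := by
  have hn : 0 < ‖x‖ := norm_pos_iff.2 hx
  rw [gLEBc_eq_frameMetric n hx, det_frameMetric, isUnit_iff_ne_zero]
  positivity

lemma christoffel_gLEBc_two {x : E4} (hx : x ≠ 0) (k i j : Fin 4) :
    christoffel (gLEBc 2) k i j x = invChr (fun r => ehCoef r (‖x‖ ^ 2)) x k i j := by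
  refine christoffel_eq_of_lower (T := fun k => invChr (fun r => ehCoef r (‖x‖ ^ 2)) x k i j)
    (isUnit_det_gLEBc 2 hx) (fun l => ?_) k
  have ht : 0 ≤ ‖x‖ ^ 2 := by positivity
  have hE : 2 * ‖x‖ ^ 2 + 1 ≠ 0 := by positivity
  have hF : ‖x‖ ^ 2 + 1 ≠ 0 := by positivity
  have dE : HasDerivAt (fun t : ℝ => 2 * t + 1) 2 (‖x‖ ^ 2) := by
    simpa using ((hasDerivAt_id (‖x‖ ^ 2)).const_mul 2).add_const 1
  have dF : HasDerivAt (fun t : ℝ => t + 1) 1 (‖x‖ ^ 2) := (hasDerivAt_id _).add_const 1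
  have ha := dF.div (dE.pow 2) (pow_ne_zero 2 hE)
  have hb := (dF.const_mul (-2)).div (dE.pow 3) (pow_ne_zero 3 hE)
  have hc := (hasDerivAt_id (‖x‖ ^ 2)).neg.div ((dE.pow 2).mul dF)
    (mul_ne_zero (pow_ne_zero 2 hE) hF)
  have key : ∀ l i j, pd l (fun y => gLEBc 2 y i j) x = _ := fun l i j =>
    ((hasPD_invForm ha hb hc i j).congr (g := fun y => gLEBc 2 y i j) (by
      filter_upwards [isOpen_ne.mem_nhds hx] with y hy
      exact gLEBc_two_apply hy i j)).pd_eq l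
  rw [key, key, key]
  simp only [gLEBc_two_apply hx]
  simp only [Pi.div_apply, Pi.mul_apply, Pi.pow_apply, Pi.neg_apply, id_eq]
  -- The functions `ehCoef` are the solution of this triangular system for the present metric.
  refine dInvForm_eq_invChr ?_ ?_ ?_ ?_ ?_ ?_ l i j
  all_goals
    generalize ‖x‖ ^ 2 = t at *
    simp [ehCoef]
    field_simp
    try ring

/-- The Ricci tensor in terms of the Christoffel symbols and their derivatives. -/
def ricciOf (c d : Fin 6 → ℝ) (x : E4) (i j : Fin 4) : ℝ :=
  ∑ k, (dInvChr c d x k k i j - dInvChr c d x j k i k +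
    ∑ l, (invChr c x k i j * invChr c x l k l - invChr c x k i l * invChr c x l j k))

lemma ricci_gLEBc_two {x : E4} (hx : x ≠ 0) (i j : Fin 4) :
    ricci (gLEBc 2) i j x =
      ricciOf (fun r => ehCoef r (‖x‖ ^ 2)) (fun r => ehCoef' r (‖x‖ ^ 2)) x i j := by
  have key : ∀ m k i j, pd m (christoffel (gLEBc 2) k i j) x =
      dInvChr (fun r => ehCoef r (‖x‖ ^ 2)) (fun r => ehCoef' r (‖x‖ ^ 2)) x m k i j :=
    fun m k i j =>
      ((hasPD_invChr (fun r => hasDerivAt_ehCoef r (by positivity)) k i j).congr (by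
        filter_upwards [isOpen_ne.mem_nhds hx] with y hy
        exact christoffel_gLEBc_two hy k i j)).pd_eq m
  unfold ricci ricciOf
  simp only [key, christoffel_gLEBc_two hx]

lemma single_ne_zero {s : ℝ} (hs : 0 < s) : (EuclideanSpace.single 0 s : E4) ≠ 0 := by
  intro h
  have := congrArg norm h
  simp [hs.ne'] at this

lemma norm_single {s : ℝ} (hs : 0 < s) : ‖(EuclideanSpace.single 0 s : E4)‖ = s := by
  simp [abs_of_pos hs]

/-- On the ray (s, 0, 0, 0) the frame is aligned with the axes and the inverse metric is diagonal,
so the four diagonal Ricci entries suffice for the scalar curvature. -/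
lemma ricciOf_single_zero (c d : Fin 6 → ℝ) (s : ℝ) :
    ricciOf c d (EuclideanSpace.single 0 s) 0 0 =
      3 * c 0 - 3 * c 2 - 3 * c 5 + s ^ 2 * (3 * c 0 * c 2 + c 0 * c 5 + 3 * c 1 + 3 * c 2 ^ 2 - 5 * c 4 -
        c 5 ^ 2 - 6 * d 2 - 2 * d 5) +
      s ^ 4 * (c 0 * c 4 + 3 * c 1 * c 2 + c 1 * c 5 - 2 * c 4 * c 5 - 2 * d 4) +
      s ^ 6 * (c 1 * c 4 - c 4 ^ 2) := by
  simp [ricciOf, dInvChr, invChr, Fin.sum_univ_four, kd, jm, frame]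
  ring

lemma ricciOf_single_one (c d : Fin 6 → ℝ) (s : ℝ) :
    ricciOf c d (EuclideanSpace.single 0 s) 1 1 =
      3 * c 0 - 3 * c 2 - 3 * c 5 + s ^ 2 * (2 * d 0 - 4 * d 5 - 3 * c 0 * c 5 + 3 * c 0 * c 2 + c 0 ^ 2 +
        6 * c 3 - 6 * c 5 * c 2 + 4 * c 5 ^ 2 - c 1 + c 4) +
      s ^ 4 * (2 * d 3 + c 0 * c 3 + c 0 * c 1 - c 0 * c 4 - c 3 * c 5 + 3 * c 3 * c 2 - 2 * c 5 * c 1 +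
        2 * c 5 * c 4) +
      s ^ 6 * (c 3 * c 1 - c 3 * c 4) := by
  simp [ricciOf, dInvChr, invChr, Fin.sum_univ_four, kd, jm, frame]
  ring

lemma ricciOf_single_two (c d : Fin 6 → ℝ) (s : ℝ) :
    ricciOf c d (EuclideanSpace.single 0 s) 2 2 =
      3 * c 0 - 3 * c 2 - 3 * c 5 + s ^ 2 * (2 * d 0 + 3 * c 0 * c 2 + c 0 * c 5 + c 0 ^ 2 - c 1 - c 4) +
      s ^ 4 * (c 0 * c 1 + c 0 * c 4) := by
  simp [ricciOf, dInvChr, invChr, Fin.sum_univ_four, kd, jm, frame]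
  ring

lemma ricciOf_single_three (c d : Fin 6 → ℝ) (s : ℝ) :
    ricciOf c d (EuclideanSpace.single 0 s) 3 3 =
      3 * c 0 - 3 * c 2 - 3 * c 5 + s ^ 2 * (2 * d 0 + 3 * c 0 * c 2 + c 0 * c 5 + c 0 ^ 2 - c 1 - c 4) +
      s ^ 4 * (c 0 * c 1 + c 0 * c 4) := by
  simp [ricciOf, dInvChr, invChr, Fin.sum_univ_four, kd, jm, frame]
  ring

lemma scalarCurvature_gLEBc_two {s : ℝ} (hs : 0 < s) :
    scalarCurvature (gLEBc 2) (EuclideanSpace.single 0 s) =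
      48 * (2 * s ^ 2 + 1) / (s ^ 2 + 1) := by
  have hx := single_ne_zero hs
  -- On this ray index 0 is radial, index 1 is the Hopf direction, and 2 and 3 are horizontal.
  have hinv : ∀ i j, (gLEBc 2 (EuclideanSpace.single 0 s))⁻¹ i j =
      if i = j then ![(2 * s ^ 2 + 1) ^ 3 / (s ^ 2 + 1), (s ^ 2 + 1) * (2 * s ^ 2 + 1),
        (2 * s ^ 2 + 1) ^ 2 / (s ^ 2 + 1), (2 * s ^ 2 + 1) ^ 2 / (s ^ 2 + 1)] i else 0 := by
    intro i j
    rw [gLEBc_eq_frameMetric 2 hx, norm_single hs, frameMetric_inv (by positivity)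
      (by positivity) (by positivity) hx, norm_single hs, Matrix.smul_apply, frameMetric_apply,
      smul_eq_mul]
    fin_cases i <;> fin_cases j <;> simp [frame] <;> field_simp
  unfold scalarCurvature
  simp only [hinv, ite_mul, zero_mul, Finset.sum_ite_eq, Finset.mem_univ, if_true,
    Fin.sum_univ_four, ricci_gLEBc_two hx, ricciOf_single_zero, ricciOf_single_one,
    ricciOf_single_two, ricciOf_single_three, norm_single hs]
  simp [ehCoef, ehCoef']
  field_simp
  ring

/-! ### Invariant functions on the orbifold -/

lemma contDiff_single (k : Fin 4) : ContDiff ℝ ∞ fun s : ℝ => (EuclideanSpace.single k s : E4) := by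
  have : (fun s : ℝ => (EuclideanSpace.single k s : E4)) =
      fun s : ℝ => s • (EuclideanSpace.single k 1 : E4) := by
    ext s i
    simp
  rw [this]
  exact contDiff_id.smul contDiff_const

lemma contDiff_radial {n : ℕ} {f : Orb n → ℝ} (hf : IsSmooth n f) : ContDiff ℝ ∞ (radial f) :=
  hf.2.2.comp (contDiff_single 0)

/-- An invariant function in terms of the fibre coordinate along a ray of a fibre. -/
def fibral {n : ℕ} (f : Orb n → ℝ) (r : ℝ) : ℝ := f (chartBdl₁ n (EuclideanSpace.single 2 r))

lemma contDiff_fibral {n : ℕ} {f : Orb n → ℝ} (hf : IsSmooth n f) : ContDiff ℝ ∞ (fibral f) :=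
  hf.1.comp (contDiff_single 2)

/-- The representatives (s, 0; 1) and (1, 0; 1/s) differ by the scaling s. This converts smoothness
across ℙ¹ into control as s → ∞. -/
lemma radial_eq_fibral {n : ℕ} (f : Orb n → ℝ) {s : ℝ} (hs : 0 < s) :
    radial f s = fibral f (1 / s) := by
  refine congrArg f (Quotient.sound ?_).symm
  refine ⟨s, hs, 1, ?_, ?_⟩
  · ext i
    fin_cases i <;> simp [cx, cy, Complex.ext_iff]
  · simp [cy, Complex.ext_iff, hs.ne']

/-- A unitary matrix that takes `(a, b) / √(|a|² + |b|²)` to `(1, 0)`. -/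
lemma exists_unitary_mulVec (a b : ℂ) {r : ℝ} (hr : 0 < r)
    (h : Complex.normSq a + Complex.normSq b = r ^ 2) :
    ∃ A : Matrix.unitaryGroup (Fin 2) ℂ,
      (A : Matrix (Fin 2) (Fin 2) ℂ) *ᵥ ![a, b] = ![(r : ℂ), 0] := by
  have hrc : (r : ℂ) ≠ 0 := by exact_mod_cast hr.ne'
  have h' : a * star a + b * star b = (r : ℂ) ^ 2 := by
    have e1 := Complex.mul_conj a
    have e2 := Complex.mul_conj b
    rw [Complex.star_def, e1, e2]
    exact_mod_cast h
  refine ⟨⟨!![star a / r, star b / r; -b / r, a / r], ?_⟩, ?_⟩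
  · rw [Matrix.mem_unitaryGroup_iff]
    ext i j
    fin_cases i <;> fin_cases j <;>
      simp [Matrix.mul_apply, Matrix.star_apply] <;> field_simp <;>
      simp only [Complex.star_def] at h' <;> first | linear_combination h' | ring1
  · ext i
    fin_cases i <;> simp [Matrix.mulVec, dotProduct] <;> field_simp <;>
      simp only [Complex.star_def] at h' <;> first | linear_combination h' | ring1

/-- `U(2)` is transitive on the spheres of ℂ². -/
lemma apply_chartOrb {n : ℕ} {f : Orb n → ℝ} (hf : ∀ A p, f (Orb.act n A p) = f p) {x : E4}
    (hx : x ≠ 0) : f (chartOrb n x) = radial f ‖x‖ := by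
  have hn : 0 < ‖x‖ := norm_pos_iff.2 hx
  obtain ⟨A, hA⟩ := exists_unitary_mulVec (cx x) (cy x) hn (by
    rw [norm_sq_eq, Complex.normSq_apply, Complex.normSq_apply]; simp [cx, cy]; ring)
  rw [← hf A (chartOrb n x)]
  refine congrArg f (congrArg (Quotient.mk (coneSetoid n)) (Subtype.ext (Prod.ext ?_ rfl)))
  refine hA.trans ?_
  ext i
  fin_cases i <;> simp [cx, cy, Complex.ext_iff]

/-! ### Nonexistence -/

lemma no_solution_of_flux_eq {K f : Orb 2 → ℝ} (hK : K ∈ X 2)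
    (hK' : ∀ s : ℝ, 0 ≤ s → deriv (radial K) s ≤ 0) (hf : f ∈ X 2)
    (hode : ∀ s, 0 < s → deriv (flux (radial f)) s =
      -(radial K s * radial f s ^ 3 * s * (1 + s ^ 2) / (2 * s ^ 2 + 1) ^ 3)) : False :=
  no_positive_radial_solution (contDiff_radial hf.1)
    ((contDiff_radial hK.1).differentiable (by simp)) (contDiff_fibral hf.1)
    (contDiff_fibral hK.1).continuous (fun _ => radial_eq_fibral f) (fun _ => radial_eq_fibral K)
    (fun _ => hf.2.2 _) (fun _ => hK.2.2 _) hK' hode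

lemma hasDerivAt_quotient {f v : ℝ → ℝ} (hf : Differentiable ℝ f)
    (hv : ∀ s : ℝ, 0 < s → v s = f s / (2 + 1 / s ^ 2)) {s : ℝ} (hs : 0 < s) :
    HasDerivAt v (s / (2 * s ^ 2 + 1) * flux f s) s := by
  have hE : 2 * s ^ 2 + 1 ≠ 0 := by positivity
  have ds : HasDerivAt (fun s : ℝ => s ^ 2) (2 * s) s := by simpa using hasDerivAt_pow 2 s
  have d := (ds.mul (hf s).hasDerivAt).div (hasDerivAt_two_mul_sq_add_one s) hE
  refine (d.congr_of_eventuallyEq (f₁ := v) ?_).congr_deriv ?_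
  · filter_upwards [lt_mem_nhds hs] with t ht
    rw [hv t ht]
    simp
    field_simp
  · simp [flux]
    field_simp
    ring

theorem no_solution_ALE {K : Orb 2 → ℝ} (hK : K ∈ X 2)
    (hK' : ∀ s : ℝ, 0 ≤ s → deriv (radial K) s ≤ 0) :
    ¬ ∃ v ∈ Y 2, SolvesALE 2 K v := by
  rintro ⟨v, ⟨f, hf, hv⟩, hsol⟩
  push_cast at hv
  have hfc := contDiff_radial hf.1
  have hfd : Differentiable ℝ (radial f) := hfc.differentiable (by simp)
  refine no_solution_of_flux_eq hK hK' hf fun s hs => ?_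
  have hx := single_ne_zero hs
  have h := hsol _ hx
  rw [laplacian_gLEB 2 (W' := deriv (flux (radial f)) s) hx
    (fun s hs => (hasDerivAt_quotient hfd hv hs).differentiableAt) ?_] at h
  · change _ = - radial K s * _ at h
    rw [norm_single hs, hv s hs] at h
    have e : deriv (flux (radial f)) s = (s ^ 2 + 1) / s ^ 5 *
        (s ^ 5 / (s ^ 2 + 1) * deriv (flux (radial f)) s) := by field_simp
    rw [e, h]
    field_simp
    ring
  · rw [norm_single hs]
    refine ((differentiable_flux hfc) s).hasDerivAt.congr_of_eventuallyEq ?_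
    filter_upwards [lt_mem_nhds hs] with t ht
    rw [(hasDerivAt_quotient hfd hv ht).deriv]
    push_cast
    field_simp

/-- The conformal covariance is verified by hand on radial functions: the term in u inside `hW`
contributes 8(2s² + 1)/(s² + 1) · u to the Laplacian, which is R u / 6. -/
theorem no_solution_conf {K : Orb 2 → ℝ} (hK : K ∈ X 2)
    (hK' : ∀ s : ℝ, 0 ≤ s → deriv (radial K) s ≤ 0) :
    ¬ ∃ u ∈ X 2, SolvesConf 2 K u := by
  rintro ⟨u, hu, hsol⟩
  have huc := contDiff_radial hu.1
  have hud : Differentiable ℝ (radial u) := huc.differentiable (by simp)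
  refine no_solution_of_flux_eq hK hK' hu fun s hs => ?_
  have hx := single_ne_zero hs
  have hE : 2 * s ^ 2 + 1 ≠ 0 := by positivity
  have h := hsol _ hx
  have hrad : (fun y => u (chartOrb 2 y)) = fun y => radial u ‖y‖ := by
    funext y
    by_cases hy : y = 0
    · subst hy
      exact congrArg (fun y => u (chartOrb 2 y)) (by ext i; simp)
    · exact apply_chartOrb hu.2.1 hy
  rw [hrad] at h
  have dE := hasDerivAt_two_mul_sq_add_one s
  have d1 := (hasDerivAt_pow 2 s).div dE hE
  have d2 := (hasDerivAt_pow 2 s).div (dE.pow 2) (pow_ne_zero 2 hE)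
  have hW : HasDerivAt (fun s : ℝ => s ^ 3 / ((2 : ℕ) * s ^ 2 + 1) * deriv (radial u) s)
      (s ^ 2 / (2 * s ^ 2 + 1) * deriv (flux (radial u)) s +
        4 * s ^ 3 / (2 * s ^ 2 + 1) ^ 3 * 2 * radial u s) s := by
    -- With E = 2s² + 1, s³ u'/E = (s²/E) · flux - 2 (s²/E²) u. Since (s²/E)' = 2s/E², the terms in
    -- u' cancel after differentiation.
    have d := (d1.mul ((differentiable_flux huc) s).hasDerivAt).sub
      ((d2.mul (hud s).hasDerivAt).const_mul 2)
    refine (d.congr_of_eventuallyEq ?_).congr_deriv ?_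
    · filter_upwards [lt_mem_nhds hs] with t ht
      simp [flux]
      field_simp
      ring
    · simp [flux]
      field_simp
      ring
  rw [laplacian_gLEBc 2 hx (fun s _ => hud s) (by rw [norm_single hs]; exact hW),
    norm_single hs, scalarCurvature_gLEBc_two hs] at h
  change - _ + _ * radial u s = radial K s * radial u s ^ 3 at h
  have e : deriv (flux (radial u)) s =
      -(s * (1 + s ^ 2) / (2 * s ^ 2 + 1) ^ 3) * (radial K s * radial u s ^ 3) := by
    rw [← h]
    push_cast
    field_simp
    ring
  rw [e]
  ring

end LeBrun

end

theorem mainTheorem11 (K : LeBrun.Orb 2 → ℝ) (hK : K ∈ LeBrun.X 2)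
    (hK' : ∀ s : ℝ, 0 ≤ s → deriv (LeBrun.radial K) s ≤ 0) :
    (¬ ∃ v ∈ LeBrun.Y 2, LeBrun.SolvesALE 2 K v) ∧
    (¬ ∃ u ∈ LeBrun.X 2, LeBrun.SolvesConf 2 K u) :=
  ⟨LeBrun.no_solution_ALE hK hK', LeBrun.no_solution_conf hK hK'⟩
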